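/- Let $\mathbb N=\{1,2,\dots\}$, let $(a_n)_{n\ge1}$ and $(b_{n,j})_{n,j\ge1}$ be real numbers with $a_n\ge0$, $b_{n,j}\ge0$ for all $n,j$ and $b_{n,j}=0$ for $n\ge j$, and let $w=(w_n)_{n\ge1}$ satisfy $w_n\ge n$ for all $n$ and, for some $\kappa\in(0,1]$, $$\sum_{n=1}^{j-1}w_nb_{n,j}\le\kappa w_j\qquad(j\ge2).\tag{1}$$ Assume that mass is conserved: $a_1=0$ and $\sum_{n=1}^{j-1}nb_{n,j}=j$ for all $j\ge2$. Let $\ell^1_w$ be the space of (real or complex) sequences $f=(f_n)_{n\ge1}$ with $\|f\|_w=\sum_{n}w_n|f_n|<\infty$, and let $A^{(w)}f=(-a_nf_n)_n$ and $B^{(w)}f=\bigl(\sum_{j>n}a_jb_{n,j}f_j\bigr)_n$, each defined on the set of those $f\in\ell^1_w$ whose image lies in $\ell^1_w$. Then $A^{(w)}+B^{(w)}$ is closable and its closure is the generator of a unique $C_0$-semigroup $(S^{(w)}(t))_{t\ge0}$ on $\ell^1_w$. Put $M_1(f)=\sum_n nf_n$ for $f\in\ell^1_w$ and $e_1=(1,0,0,\dots)$.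 (i) $\lim_{t\to\infty}\|S^{(w)}(t)u-M_1(u)e_1\|_w=0$ for all $u\in\ell^1_w$ if and only if $a_n>0$ for all $n\ge2$. (ii) Suppose that (1) holds with some $\kappa\in(0,1)$ and let $\widehat a_0=\inf_{n\ge2}a_n$. Then, for all $u\in\ell^1_w$ and $t\ge0$, $$\|S^{(w)}(t)u-M_1(u)e_1\|_w\le(w_1+1)e^{-(1-\kappa)\widehat a_0t}\|u\|_w,$$ and so, if $\widehat a_0>0$ and $0\le\alpha<(1-\kappa)\widehat a_0$, then $$\lim_{t\to\infty}e^{\alpha t}\|S^{(w)}(t)u-M_1(u)e_1\|_w=0\qquad\text{for all }u\in\ell^1_w.\tag{2}$$ Statement (2) fails for every $\alpha>\widehat a_0$; in particular, if $\widehat a_0=0$, then (2) fails for every $\alpha>0$. -/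

import Mathlib

open Filter Topology
open scoped NNReal

noncomputable section

/-- A weight: a sequence `(w_n)_{n ≥ 1}` of positive real numbers. -/
structure Weight where
  val : ℕ+ → ℝ
  pos : ∀ n, 0 < val n

instance : CoeFun Weight (fun _ => ℕ+ → ℝ) := ⟨Weight.val⟩

/-- The linear space of all scalar sequences `f` with `∑ w_n |f_n| < ∞`. -/
def weightedL1Submodule (𝕜 : Type*) [RCLike 𝕜] (w : Weight) : Submodule 𝕜 (ℕ+ → 𝕜) where
  carrier := {f | Summable fun n => w n * ‖f n‖}
  zero_mem' := by simp [summable_zero]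
  add_mem' := by
    intro f g hf hg
    refine Summable.of_nonneg_of_le (fun n => mul_nonneg (w.pos n).le (norm_nonneg _))
      (fun n => ?_) (Summable.add hf hg)
    rw [← mul_add]
    exact mul_le_mul_of_nonneg_left (norm_add_le _ _) (w.pos n).le
  smul_mem' := by
    intro c f hf
    refine (Summable.mul_left ‖c‖ hf).congr (fun n => ?_)
    simp only [Pi.smul_apply, norm_smul]
    ring

/-- The weighted space `ℓ¹_w`. -/
def WeightedL1 (𝕜 : Type*) [RCLike 𝕜] (w : Weight) : Type _ := weightedL1Submodule 𝕜 w

namespace WeightedL1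

variable {𝕜 : Type*} [RCLike 𝕜] {w : Weight}

instance : AddCommGroup (WeightedL1 𝕜 w) := inferInstanceAs (AddCommGroup (weightedL1Submodule 𝕜 w))

instance : Module 𝕜 (WeightedL1 𝕜 w) := inferInstanceAs (Module 𝕜 (weightedL1Submodule 𝕜 w))

instance : CoeFun (WeightedL1 𝕜 w) (fun _ => ℕ+ → 𝕜) := ⟨fun f => f.1⟩

/-- The element of `ℓ¹_w` given by a sequence in it. -/
def mk (f : ℕ+ → 𝕜) (hf : Summable fun n => w n * ‖f n‖) : WeightedL1 𝕜 w := ⟨f, hf⟩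

@[simp] theorem mk_apply (f : ℕ+ → 𝕜) (hf : Summable fun n => w n * ‖f n‖) (n : ℕ+) :
    (mk f hf : WeightedL1 𝕜 w) n = f n := rfl

@[ext] theorem ext {f g : WeightedL1 𝕜 w} (h : ∀ n, f n = g n) : f = g := Subtype.ext (funext h)

@[simp] theorem zero_apply (n : ℕ+) : (0 : WeightedL1 𝕜 w) n = 0 := rfl
@[simp] theorem add_apply (f g : WeightedL1 𝕜 w) (n : ℕ+) : (f + g) n = f n + g n := rfl
@[simp] theorem neg_apply (f : WeightedL1 𝕜 w) (n : ℕ+) : (-f) n = -f n := rfl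
@[simp] theorem sub_apply (f g : WeightedL1 𝕜 w) (n : ℕ+) : (f - g) n = f n - g n := rfl
@[simp] theorem smul_apply (c : 𝕜) (f : WeightedL1 𝕜 w) (n : ℕ+) : (c • f) n = c * f n := rfl

theorem summable (f : WeightedL1 𝕜 w) : Summable fun n => w n * ‖f n‖ := f.2

/-- The norm `‖f‖_w = ∑ w_n |f_n|`. -/
instance : Norm (WeightedL1 𝕜 w) := ⟨fun f => ∑' n, w n * ‖f n‖⟩

theorem norm_def (f : WeightedL1 𝕜 w) : ‖f‖ = ∑' n, w n * ‖f n‖ := rfl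

theorem normCore : NormedSpace.Core 𝕜 (WeightedL1 𝕜 w) where
  norm_nonneg f := tsum_nonneg fun n => mul_nonneg (w.pos n).le (norm_nonneg _)
  norm_smul c f := by
    rw [norm_def, norm_def, ← tsum_mul_left]
    refine tsum_congr fun n => ?_
    rw [smul_apply, norm_mul]
    ring
  norm_triangle f g := by
    rw [norm_def, norm_def, norm_def, ← f.summable.tsum_add g.summable]
    refine (f + g).summable.tsum_le_tsum (fun n => ?_) (f.summable.add g.summable)
    rw [← mul_add]
    exact mul_le_mul_of_nonneg_left (norm_add_le _ _) (w.pos n).le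
  norm_eq_zero_iff f := by
    constructor
    · intro h
      have hs : HasSum (fun n => w n * ‖f n‖) 0 := h ▸ norm_def f ▸ f.summable.hasSum
      have h0 := (hasSum_zero_iff_of_nonneg
        (fun n => mul_nonneg (w.pos n).le (norm_nonneg (f n)))).1 hs
      ext n
      have hn : w n * ‖f n‖ = 0 := congrFun h0 n
      simpa [(w.pos n).ne'] using hn
    · rintro rfl
      simp [norm_def]

instance : NormedAddCommGroup (WeightedL1 𝕜 w) := NormedAddCommGroup.ofCore normCore

instance : NormedSpace 𝕜 (WeightedL1 𝕜 w) := NormedSpace.ofCore normCore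

/-- The unit sequence `e_n`. -/
def unit (w : Weight) (n : ℕ+) : WeightedL1 𝕜 w :=
  mk (Pi.single n 1) (summable_of_ne_finset_zero (s := {n}) fun k hk => by
    rw [Pi.single_eq_of_ne (by simpa using hk), norm_zero, mul_zero])

/-- The total mass `M₁(f) = ∑ n f_n`. -/
def mass (f : WeightedL1 𝕜 w) : 𝕜 := ∑' n : ℕ+, ((n : ℕ) : 𝕜) * f n

end WeightedL1

/-- The operator `A^{(w)}`: `(A f)_n = -a_n f_n`, on `{f ∈ ℓ¹_w : A f ∈ ℓ¹_w}`. -/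
def lossOp (𝕜 : Type*) [RCLike 𝕜] (a : ℕ+ → ℝ) (w : Weight) :
    WeightedL1 𝕜 w →ₗ.[𝕜] WeightedL1 𝕜 w where
  domain :=
    { carrier := {f | (fun n => -(a n : 𝕜) * f n) ∈ weightedL1Submodule 𝕜 w}
      zero_mem' := by
        rw [Set.mem_ofPred_eq]
        convert (weightedL1Submodule 𝕜 w).zero_mem using 1
        ext n; simp
      add_mem' := by
        intro f g hf hg
        rw [Set.mem_ofPred_eq]
        convert (weightedL1Submodule 𝕜 w).add_mem hf hg using 1
        ext n; simp; ring
      smul_mem' := by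
        intro c f hf
        rw [Set.mem_ofPred_eq]
        convert (weightedL1Submodule 𝕜 w).smul_mem c hf using 1
        ext n; simp; ring }
  toFun :=
    { toFun := fun f => WeightedL1.mk (fun n => -(a n : 𝕜) * f.1 n) f.2
      map_add' := by intro f g; ext n; simp; ring
      map_smul' := by intro c f; ext n; simp; ring }

/-- The operator `B^{(w)}`: `(B f)_n = ∑_{j > n} a_j b_{n,j} f_j`, on
`{f ∈ ℓ¹_w : B f ∈ ℓ¹_w}`; the series defining `B f` are required to converge. -/
def gainOp (𝕜 : Type*) [RCLike 𝕜] (a : ℕ+ → ℝ) (b : ℕ+ → ℕ+ → ℝ) (w : Weight) :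
    WeightedL1 𝕜 w →ₗ.[𝕜] WeightedL1 𝕜 w where
  domain :=
    { carrier := {f | (∀ n, Summable fun j : Set.Ioi n => ((a j * b n j : ℝ) : 𝕜) * f j) ∧
        (fun n => ∑' j : Set.Ioi n, ((a j * b n j : ℝ) : 𝕜) * f j) ∈ weightedL1Submodule 𝕜 w}
      zero_mem' := by
        refine ⟨fun n => by simp [summable_zero], ?_⟩
        convert (weightedL1Submodule 𝕜 w).zero_mem using 1
        ext n; simp
      add_mem' := by
        rintro f g ⟨hf, hf'⟩ ⟨hg, hg'⟩
        refine ⟨fun n => ((hf n).add (hg n)).congr fun j => by simp [mul_add], ?_⟩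
        convert (weightedL1Submodule 𝕜 w).add_mem hf' hg' using 1
        ext n
        simp only [WeightedL1.add_apply, mul_add, Pi.add_apply]
        exact (hf n).tsum_add (hg n)
      smul_mem' := by
        rintro c f ⟨hf, hf'⟩
        refine ⟨fun n => ((hf n).mul_left c).congr fun j => by
          simp only [WeightedL1.smul_apply]; ring, ?_⟩
        convert (weightedL1Submodule 𝕜 w).smul_mem c hf' using 1
        ext n
        simp only [WeightedL1.smul_apply, Pi.smul_apply, smul_eq_mul, mul_left_comm _ c]
        exact tsum_mul_left }
  toFun :=
    { toFun := fun f =>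
        WeightedL1.mk (fun n => ∑' j : Set.Ioi n, ((a j * b n j : ℝ) : 𝕜) * f.1 j) f.2.2
      map_add' := by
        intro f g; ext n
        simp only [Submodule.coe_add, WeightedL1.mk_apply, WeightedL1.add_apply, mul_add]
        exact (f.2.1 n).tsum_add (g.2.1 n)
      map_smul' := by
        intro c f; ext n
        simp only [Submodule.coe_smul, WeightedL1.mk_apply, WeightedL1.smul_apply,
          RingHom.id_apply, mul_left_comm _ c]
        exact tsum_mul_left }

/-- A `C₀`-semigroup of bounded linear operators on a normed space. -/
structure C0Semigroup (𝕜 X : Type*) [RCLike 𝕜] [NormedAddCommGroup X] [NormedSpace 𝕜 X] where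
  op : ℝ≥0 → X →L[𝕜] X
  op_zero : op 0 = ContinuousLinearMap.id 𝕜 X
  op_add : ∀ s t, op (s + t) = (op s).comp (op t)
  strongly_continuous : ∀ x, Continuous fun t => op t x

/-- `G` is the (infinitesimal) generator of `S`: `x` lies in the domain of `G` and `G x = y`
exactly when `t⁻¹ (S(t) x - x) → y` as `t → 0+`. -/
def C0Semigroup.HasGenerator {𝕜 X : Type*} [RCLike 𝕜] [NormedAddCommGroup X] [NormedSpace 𝕜 X]
    (S : C0Semigroup 𝕜 X) (G : X →ₗ.[𝕜] X) : Prop :=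
  ∀ x y, (x, y) ∈ G.graph ↔
    Tendsto (fun t : ℝ≥0 => (((t : ℝ)⁻¹ : ℝ) : 𝕜) • (S.op t x - x)) (𝓝[>] 0) (𝓝 y)

end

/-! The system is triangular: `(A+B)e_n = -a_n e_n + ∑_{m<n} a_n b_{m,n} e_m`. So for any semigroup
`S` generated by the closure, the vectors `p_n(t) = S(t)e_n` satisfy `p_n' = -a_n p_n + a_n ∑_{m<n}
b_{m,n} p_m`. These are scalar relaxation equations with values in `ℓ¹_w`, each forced only by
finitely many earlier ones, and they can be solved, compared and estimated by induction on `n`.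
Since `ℓ¹_w` is an `ℓ¹` space, a family `v_n` with `‖v_n‖ ≤ C w_n` extends to a bounded operator of
norm at most `C`, so everything reduces to unit sequences.

Generation: the flow started at `(e_n)` satisfies `‖p_n‖ ≤ w_n` by (1), and extends to a contraction
semigroup. Its generator contains the closure of `A+B`. Equality follows because `1 - (A+B)` is onto
after closure (solve for each `e_n` recursively), while `1 - G` is injective by dissipativity of the
generator `G`. Uniqueness is uniqueness for the triangular system.

Asymptotics: mass conservation makes `n e_1` a stationary flow, so the deviation `S(t)e_n - n e_1`
is again a flow, and it vanishes for `n = 1`. The inductive estimate `IsFragmentationFlow.norm_le`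
gives the rate `(1-κ)â₀`. With `κ = 1` it gives the uniform bound that turns convergence on each
`e_n` into convergence for every `u`, by dominated convergence. Conversely, the `n`-th coordinate of
`S(t)e_n` is exactly `e^{-a_n t}`, which rules out convergence if some `a_n = 0`, and any rate above
`â₀`. -/

/-! ### Linear relaxation equations -/

section Relaxation

variable {E : Type*} [NormedAddCommGroup E] [NormedSpace ℝ E]

/-- Comparison principle for `y' = -a y + g`, with right derivatives. -/
theorem norm_le_of_relaxation {y g : ℝ → E} {B B' : ℝ → ℝ} {a T : ℝ}
    (hy : ContinuousOn y (Set.Ici T))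
    (hd : ∀ t, T ≤ t → HasDerivWithinAt y (-a • y t + g t) (Set.Ici t) t)
    (hB : ∀ t, HasDerivAt B (B' t) t) (h0 : ‖y T‖ ≤ B T)
    (hg : ∀ t, T ≤ t → ‖g t‖ ≤ B' t + a * B t) {t : ℝ} (ht : T ≤ t) : ‖y t‖ ≤ B t := by
  have hexp : ∀ s : ℝ, HasDerivAt (fun s => Real.exp (a * s)) (Real.exp (a * s) * a) s := fun s => by
    simpa using ((hasDerivAt_id s).const_mul a).exp
  -- The integrating factor removes the linear term: `(e^{at} y)' = e^{at} g`. The boundary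
  -- comparison then needs no integral of `g`.
  have key : ‖Real.exp (a * t) • y t‖ ≤ Real.exp (a * t) * B t := by
    refine image_norm_le_of_norm_deriv_right_le_deriv_boundary (a := T) (b := t)
      (f := fun s => Real.exp (a * s) • y s) (f' := fun s => Real.exp (a * s) • g s)
      (B := fun s => Real.exp (a * s) * B s)
      (B' := fun s => Real.exp (a * s) * a * B s + Real.exp (a * s) * B' s)
      ?_ ?_ ?_ ?_ ?_ ⟨ht, le_rfl⟩
    · exact ContinuousOn.smul (by fun_prop) (hy.mono Set.Icc_subset_Ici_self)
    · intro s hs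
      refine ((hexp s).hasDerivWithinAt.smul (hd s hs.1)).congr_deriv ?_
      module
    · rw [norm_smul, Real.norm_of_nonneg (Real.exp_pos _).le]
      gcongr
    · exact fun s => (hexp s).mul (hB s)
    · intro s hs
      rw [norm_smul, Real.norm_of_nonneg (Real.exp_pos _).le]
      calc _ ≤ Real.exp (a * s) * (B' s + a * B s) := by gcongr; exact hg s hs.1
        _ = _ := by ring
  rw [norm_smul, Real.norm_of_nonneg (Real.exp_pos _).le] at key
  exact le_of_mul_le_mul_left key (Real.exp_pos _)

/-- For the barrier `B = C e^{-βt}` one has `B' + aB = (a - β)B`, which is exactly the forcing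
allowed here. -/
theorem norm_le_exp_of_relaxation {y g : ℝ → E} {a β C : ℝ}
    (hy : ContinuousOn y (Set.Ici 0))
    (hd : ∀ t, 0 ≤ t → HasDerivWithinAt y (-a • y t + g t) (Set.Ici t) t)
    (h0 : ‖y 0‖ ≤ C) (hg : ∀ t, 0 ≤ t → ‖g t‖ ≤ (a - β) * (C * Real.exp (-β * t)))
    {t : ℝ} (ht : 0 ≤ t) : ‖y t‖ ≤ C * Real.exp (-β * t) := by
  refine norm_le_of_relaxation (B := fun t => C * Real.exp (-β * t))
    (B' := fun t => C * (Real.exp (-β * t) * -β)) hy hd (fun s => ?_) (by simpa using h0)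
    (fun s hs => (hg s hs).trans_eq (by ring)) ht
  simpa using (((hasDerivAt_id s).const_mul (-β)).exp.const_mul C)

theorem eq_zero_of_relaxation {y : ℝ → E} {a : ℝ} (hy : ContinuousOn y (Set.Ici 0))
    (hd : ∀ t, 0 ≤ t → HasDerivWithinAt y (-a • y t) (Set.Ici t) t) (h0 : y 0 = 0)
    {t : ℝ} (ht : 0 ≤ t) : y t = 0 := by
  have h := norm_le_exp_of_relaxation (β := 0) (C := 0) (g := fun _ => 0) hy
    (by simpa using hd) (by simp [h0]) (by simp) ht
  simpa using h

/-- Solutions of `y' = -a y + g` with `a > 0` vanish at infinity if the forcing does. -/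
theorem tendsto_zero_of_relaxation {y g : ℝ → E} {a : ℝ} (ha : 0 < a)
    (hy : ContinuousOn y (Set.Ici 0))
    (hd : ∀ t, 0 ≤ t → HasDerivWithinAt y (-a • y t + g t) (Set.Ici t) t)
    (hg : Tendsto g atTop (𝓝 0)) : Tendsto y atTop (𝓝 0) := by
  rw [Metric.tendsto_atTop]
  intro ε hε
  obtain ⟨T, hT⟩ := (Metric.tendsto_atTop.1 hg) (a * (ε / 2)) (by positivity)
  set T₀ := max T 0 with hT₀
  -- This barrier solves `B' + aB = a·ε/2`, the size of the forcing after `T₀`, and dominates `‖y‖`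
  -- at `T₀`.
  set B : ℝ → ℝ := fun t => ε / 2 + ‖y T₀‖ * Real.exp (a * T₀) * Real.exp (-a * t) with hBdef
  have hB : ∀ t, HasDerivAt B (‖y T₀‖ * Real.exp (a * T₀) * (Real.exp (-a * t) * -a)) t := by
    intro t
    refine HasDerivAt.const_add (ε / 2) (HasDerivAt.const_mul _ ?_)
    simpa using ((hasDerivAt_id t).const_mul (-a)).exp
  have hbound : ∀ t, T₀ ≤ t → ‖y t‖ ≤ B t := by
    intro t ht
    have hpos : (0 : ℝ) ≤ T₀ := le_max_right _ _
    refine norm_le_of_relaxation (hy.mono (Set.Ici_subset_Ici.2 hpos))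
      (fun s hs => hd s (hpos.trans hs)) hB ?_ ?_ ht
    · have : Real.exp (a * T₀) * Real.exp (-a * T₀) = 1 := by
        rw [← Real.exp_add]; simp
      simp only [hBdef, mul_assoc, this]
      linarith
    · intro s hs
      have h := hT s ((le_max_left _ _).trans hs)
      rw [dist_zero_right] at h
      refine h.le.trans_eq ?_
      simp only [hBdef]
      ring
  have hlim : Tendsto B atTop (𝓝 (ε / 2)) := by
    have : Tendsto (fun t : ℝ => Real.exp (-a * t)) atTop (𝓝 0) :=
      Real.tendsto_exp_atBot.comp (tendsto_id.const_mul_atTop_of_neg (by linarith))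
    have h := (this.const_mul (‖y T₀‖ * Real.exp (a * T₀))).const_add (ε / 2)
    rwa [mul_zero, add_zero] at h
  obtain ⟨N, hN⟩ := eventually_atTop.1 (hlim.eventually_lt_const (show ε / 2 < ε by linarith))
  refine ⟨max N T₀, fun t ht => ?_⟩
  rw [dist_zero_right]
  exact (hbound t ((le_max_right _ _).trans ht)).trans_lt (hN t ((le_max_left _ _).trans ht))

end Relaxation

/-! ### Flows of the fragmentation system -/

/-- A family `p` solving `p_n' = -a_n p_n + a_n ∑_{m < n} b_{m,n} p_m` for `t ≥ 0`. -/
structure IsFragmentationFlow {E : Type*} [NormedAddCommGroup E] [NormedSpace ℝ E]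
    (a : ℕ+ → ℝ) (b : ℕ+ → ℕ+ → ℝ) (p : ℕ+ → ℝ → E) : Prop where
  continuousOn : ∀ n, ContinuousOn (p n) (Set.Ici 0)
  hasDeriv : ∀ n t, 0 ≤ t → HasDerivWithinAt (p n)
    (-(a n) • p n t + ∑ m ∈ Finset.Ico 1 n, (a n * b m n) • p m t) (Set.Ici t) t

namespace IsFragmentationFlow

variable {E F : Type*} [NormedAddCommGroup E] [NormedSpace ℝ E]
  [NormedAddCommGroup F] [NormedSpace ℝ F]
  {a : ℕ+ → ℝ} {b : ℕ+ → ℕ+ → ℝ} {p q : ℕ+ → ℝ → E}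

theorem sub (hp : IsFragmentationFlow a b p) (hq : IsFragmentationFlow a b q) :
    IsFragmentationFlow a b fun n t => p n t - q n t where
  continuousOn n := (hp.continuousOn n).sub (hq.continuousOn n)
  hasDeriv n t ht := by
    refine ((hp.hasDeriv n t ht).sub (hq.hasDeriv n t ht)).congr_deriv ?_
    simp only [smul_sub, Finset.sum_sub_distrib]
    abel

theorem map (hp : IsFragmentationFlow a b p) (L : E →L[ℝ] F) :
    IsFragmentationFlow a b fun n t => L (p n t) where
  continuousOn n := L.continuous.comp_continuousOn (hp.continuousOn n)
  hasDeriv n t ht := by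
    refine (L.hasFDerivAt.comp_hasDerivWithinAt t (hp.hasDeriv n t ht)).congr_deriv ?_
    simp

theorem comp_add (hp : IsFragmentationFlow a b p) {s : ℝ} (hs : 0 ≤ s) :
    IsFragmentationFlow a b fun n t => p n (t + s) where
  continuousOn n := (hp.continuousOn n).comp (by fun_prop)
    fun t (ht : 0 ≤ t) => show 0 ≤ t + s by positivity
  hasDeriv n t ht := by
    have h1 : HasDerivWithinAt (fun t => t + s) 1 (Set.Ici t) t :=
      ((hasDerivAt_id t).add_const s).hasDerivWithinAt
    have h := HasDerivWithinAt.scomp t (hp.hasDeriv n (t + s) (by positivity)) h1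
      (fun r hr => show t + s ≤ r + s by simpa using hr)
    rwa [one_smul] at h

/-- Multiples of the mass are stationary. -/
theorem mass_smul (ha_one : a 1 = 0)
    (h_mass : ∀ j : ℕ+, 2 ≤ j → ∑ n ∈ Finset.Ico 1 j, ((n : ℕ) : ℝ) * b n j = ((j : ℕ) : ℝ))
    (x : E) : IsFragmentationFlow a b fun n (_ : ℝ) => ((n : ℕ) : ℝ) • x where
  continuousOn n := continuousOn_const
  hasDeriv n t _ := by
    convert hasDerivWithinAt_const t (Set.Ici t) (((n : ℕ) : ℝ) • x) using 1
    rcases eq_or_ne n 1 with rfl | hn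
    · simp [ha_one]
    · have h2 : 2 ≤ n := PNat.add_one_le_iff.2 (lt_of_le_of_ne one_le (Ne.symm hn))
      have : ∑ m ∈ Finset.Ico 1 n, (a n * b m n) • ((m : ℕ) : ℝ) • x
          = (a n * ((n : ℕ) : ℝ)) • x := by
        rw [← h_mass n h2, Finset.mul_sum, Finset.sum_smul]
        refine Finset.sum_congr rfl fun m _ => ?_
        rw [smul_smul]
        ring_nf
      rw [this, smul_smul, ← add_smul]
      simp

/-- By induction, (1) bounds the forcing of `p n` by `κ a_n C c_n e^{-βt}`, and `κ a_n ≤ a_n - β` is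
what the exponential barrier requires. The alternative in `hβ` serves `n = 1`, where `a_1 = 0` would
otherwise exclude `β > 0`. -/
theorem norm_le (hp : IsFragmentationFlow a b p) (ha : ∀ n, 0 ≤ a n) (hb : ∀ n j, 0 ≤ b n j)
    {c : ℕ+ → ℝ} {κ β C : ℝ} (hC : 0 ≤ C) (hc : ∀ n, 0 ≤ c n)
    (hκ : ∀ j, ∑ n ∈ Finset.Ico 1 j, c n * b n j ≤ κ * c j)
    (hβ : ∀ n, β ≤ (1 - κ) * a n ∨ ∀ t, 0 ≤ t → p n t = 0)
    (h0 : ∀ n, ‖p n 0‖ ≤ C * c n) (n : ℕ+) :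
    ∀ t, 0 ≤ t → ‖p n t‖ ≤ C * c n * Real.exp (-β * t) := by
  induction n using PNat.strongInductionOn with
  | _ n ih =>
    intro t ht
    rcases hβ n with h | h
    · refine norm_le_exp_of_relaxation (hp.continuousOn n) (hp.hasDeriv n) (h0 n) ?_ ht
      intro s hs
      calc _ ≤ ∑ m ∈ Finset.Ico 1 n, (a n * b m n) * (C * c m * Real.exp (-β * s)) := by
            refine norm_sum_le_of_le _ fun m hm => ?_
            rw [norm_smul, Real.norm_of_nonneg (mul_nonneg (ha n) (hb m n))]
            exact mul_le_mul_of_nonneg_left (ih m (Finset.mem_Ico.1 hm).2 s hs)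
              (mul_nonneg (ha n) (hb m n))
        _ = a n * (∑ m ∈ Finset.Ico 1 n, c m * b m n) * (C * Real.exp (-β * s)) := by
            rw [Finset.mul_sum, Finset.sum_mul]
            exact Finset.sum_congr rfl fun m _ => by ring
        _ ≤ a n * (κ * c n) * (C * Real.exp (-β * s)) := by
            have := ha n
            gcongr
            exact hκ n
        _ = (a n * κ) * (C * c n * Real.exp (-β * s)) := by ring
        _ ≤ _ := by
            refine mul_le_mul_of_nonneg_right (by linarith) ?_
            have := hc n
            positivity
    · rw [h t ht, norm_zero]
      have := hc n
      positivity

theorem eq_of_eq_zero (hp : IsFragmentationFlow a b p) (hq : IsFragmentationFlow a b q)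
    (h0 : ∀ n, p n 0 = q n 0) (n : ℕ+) : ∀ t, 0 ≤ t → p n t = q n t := by
  induction n using PNat.strongInductionOn with
  | _ n ih =>
    intro t ht
    refine sub_eq_zero.1 (eq_zero_of_relaxation (a := a n) ((hp.sub hq).continuousOn n) ?_ ?_ ht)
    · intro s hs
      convert (hp.sub hq).hasDeriv n s hs using 1
      rw [Finset.sum_eq_zero, add_zero]
      intro m hm
      rw [ih m (Finset.mem_Ico.1 hm).2 s hs, sub_self, smul_zero]
    · rw [h0, sub_self]

/-- Components below `k` stay zero, so `p k` has no forcing. -/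
theorem eq_exp_smul (hp : IsFragmentationFlow a b p) {k : ℕ+} (h0 : ∀ n < k, p n 0 = 0)
    {t : ℝ} (ht : 0 ≤ t) : p k t = Real.exp (-(a k) * t) • p k 0 := by
  have hz : ∀ n < k, ∀ s, 0 ≤ s → p n s = 0 := by
    intro n
    induction n using PNat.strongInductionOn with
    | _ n ih =>
      intro hn s hs
      refine eq_zero_of_relaxation (a := a n) (hp.continuousOn n) ?_ (h0 n hn) hs
      intro s hs
      convert hp.hasDeriv n s hs using 1
      rw [Finset.sum_eq_zero, add_zero]
      intro m hm
      have hm' := (Finset.mem_Ico.1 hm).2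
      rw [ih m hm' (hm'.trans hn) s hs, smul_zero]
  refine sub_eq_zero.1 (eq_zero_of_relaxation (a := a k)
    (y := fun t => p k t - Real.exp (-(a k) * t) • p k 0)
    ((hp.continuousOn k).sub (by fun_prop)) ?_ (by simp) ht)
  intro s hs
  have h1 : HasDerivWithinAt (fun s => Real.exp (-(a k) * s) • p k 0)
      ((Real.exp (-(a k) * s) * -(a k)) • p k 0) (Set.Ici s) s := by
    have := ((hasDerivAt_id s).const_mul (-(a k))).exp.smul_const (p k 0)
    simpa using this.hasDerivWithinAt
  refine ((hp.hasDeriv k s hs).sub h1).congr_deriv ?_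
  rw [Finset.sum_eq_zero]
  · module
  · intro m hm
    rw [hz m (Finset.mem_Ico.1 hm).2 s hs, smul_zero]

theorem tendsto_zero (hp : IsFragmentationFlow a b p) (ha : ∀ n : ℕ+, 2 ≤ n → 0 < a n)
    (h1 : ∀ t, 0 ≤ t → p 1 t = 0) (n : ℕ+) : Tendsto (p n) atTop (𝓝 0) := by
  induction n using PNat.strongInductionOn with
  | _ n ih =>
    rcases eq_or_ne n 1 with rfl | hn
    · refine tendsto_const_nhds.congr' ?_
      filter_upwards [eventually_ge_atTop 0] with t ht using (h1 t ht).symm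
    · have h2 : 2 ≤ n := PNat.add_one_le_iff.2 (lt_of_le_of_ne one_le (Ne.symm hn))
      refine tendsto_zero_of_relaxation (ha n h2) (hp.continuousOn n) (hp.hasDeriv n) ?_
      have := tendsto_finsetSum (Finset.Ico 1 n) fun m hm =>
        (ih m (Finset.mem_Ico.1 hm).2).const_smul (a n * b m n)
      simpa using this

end IsFragmentationFlow

/-! ### Construction of flows by variation of constants and recursion on the index -/

section Existence

variable {E : Type*} [NormedAddCommGroup E] [NormedSpace ℝ E]

/-- The solution of the fragmentation system with initial values `x`. -/
noncomputable def fragmentationFlow (a : ℕ+ → ℝ) (b : ℕ+ → ℕ+ → ℝ) (x : ℕ+ → E) (n : ℕ+) :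
    ℝ → E := fun t => Real.exp (-(a n) * t) • (x n + ∫ s in (0 : ℝ)..t, Real.exp (a n * s) •
      ∑ m : Finset.Ico 1 n, (a n * b m n) • fragmentationFlow a b x m s)
termination_by n
decreasing_by exact (Finset.mem_Ico.1 m.2).2

variable (a : ℕ+ → ℝ) (b : ℕ+ → ℕ+ → ℝ) (x : ℕ+ → E)

/-- The definition sums over a subtype so that `m < n` is available for termination; this is the
usable form. -/
theorem fragmentationFlow_eq (n : ℕ+) : fragmentationFlow a b x n = fun t =>
    Real.exp (-(a n) * t) • (x n + ∫ s in (0 : ℝ)..t, Real.exp (a n * s) •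
      ∑ m ∈ Finset.Ico 1 n, (a n * b m n) • fragmentationFlow a b x m s) := by
  funext t
  rw [fragmentationFlow]
  simp only [← Finset.sum_coe_sort (Finset.Ico 1 n)]

theorem fragmentationFlow_zero (n : ℕ+) : fragmentationFlow a b x n 0 = x n := by
  rw [fragmentationFlow_eq]
  simp

theorem continuous_fragmentationFlow [CompleteSpace E] (n : ℕ+) :
    Continuous (fragmentationFlow a b x n) := by
  induction n using PNat.strongInductionOn with
  | _ n ih =>
    rw [fragmentationFlow_eq]
    have hc : Continuous fun s : ℝ => Real.exp (a n * s) •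
        ∑ m ∈ Finset.Ico 1 n, (a n * b m n) • fragmentationFlow a b x m s := by
      refine Continuous.smul (by fun_prop) (continuous_finsetSum _ fun m hm => ?_)
      exact (ih m (Finset.mem_Ico.1 hm).2).const_smul _
    refine Continuous.smul (by fun_prop) (continuous_const.add ?_)
    exact intervalIntegral.continuous_primitive (fun _ _ => hc.intervalIntegrable _ _) 0

theorem isFragmentationFlow_fragmentationFlow [CompleteSpace E] :
    IsFragmentationFlow a b (fragmentationFlow a b x) where
  continuousOn n := (continuous_fragmentationFlow a b x n).continuousOn
  hasDeriv n t _ := by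
    have hc : Continuous fun s : ℝ => Real.exp (a n * s) •
        ∑ m ∈ Finset.Ico 1 n, (a n * b m n) • fragmentationFlow a b x m s := by
      refine Continuous.smul (by fun_prop) (continuous_finsetSum _ fun m hm => ?_)
      exact (continuous_fragmentationFlow a b x m).const_smul _
    have h1 := (intervalIntegral.integral_hasDerivAt_right (hc.intervalIntegrable 0 t)
      (hc.stronglyMeasurableAtFilter _ _) hc.continuousAt).const_add (x n)
    have h2 : HasDerivAt (fun s => Real.exp (-(a n) * s)) (Real.exp (-(a n) * t) * -(a n)) t := by
      simpa using ((hasDerivAt_id t).const_mul (-(a n))).exp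
    refine HasDerivAt.hasDerivWithinAt ?_
    have h3 : HasDerivAt (fragmentationFlow a b x n) _ t :=
      (h2.smul h1).congr_of_eventuallyEq
        (.of_eq (by conv_lhs => rw [fragmentationFlow_eq]
                    rfl))
    refine h3.congr_deriv ?_
    symm
    conv_lhs => rw [fragmentationFlow_eq]
    rw [smul_smul (Real.exp (-(a n) * t)), ← Real.exp_add]
    simp only [neg_mul, neg_add_cancel, Real.exp_zero, one_smul]
    module

end Existence

/-! ### The space `ℓ¹_w` -/

theorem Submodule.mem_of_hasSum {R M ι : Type*} [Semiring R] [AddCommMonoid M] [Module R M]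
    [TopologicalSpace M] (K : Submodule R M) (hK : IsClosed (K : Set M)) {f : ι → M} {x : M}
    (hf : HasSum f x) (h : ∀ i, f i ∈ K) : x ∈ K :=
  hK.mem_of_tendsto hf (Eventually.of_forall fun _ => K.sum_mem fun i _ => h i)

namespace WeightedL1

variable {𝕜 : Type*} [RCLike 𝕜] {w : Weight}

/-- Time derivatives and integrals are taken over `ℝ`, whichever scalar field is used. -/
noncomputable instance realNormedSpace : NormedSpace ℝ (WeightedL1 𝕜 w) :=
  NormedSpace.restrictScalars ℝ 𝕜 (WeightedL1 𝕜 w)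

instance realIsScalarTower : IsScalarTower ℝ 𝕜 (WeightedL1 𝕜 w) :=
  IsScalarTower.of_algebraMap_smul fun _ _ => rfl

@[simp] theorem real_smul_apply (c : ℝ) (f : WeightedL1 𝕜 w) (n : ℕ+) :
    (c • f) n = (c : 𝕜) * f n := by
  rw [RCLike.real_smul_eq_coe_smul (K := 𝕜), smul_apply]

theorem weight_mul_norm_apply_le (f : WeightedL1 𝕜 w) (n : ℕ+) : w n * ‖f n‖ ≤ ‖f‖ :=
  f.summable.le_tsum n fun k _ => mul_nonneg (w.pos k).le (norm_nonneg _)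

/-- The `n`-th coordinate as a continuous linear functional. -/
noncomputable def coord (n : ℕ+) : WeightedL1 𝕜 w →L[𝕜] 𝕜 :=
  LinearMap.mkContinuous
    { toFun := fun f => f n
      map_add' := fun _ _ => rfl
      map_smul' := fun _ _ => rfl } (w n)⁻¹ fun f => by
    rw [← div_eq_inv_mul, le_div_iff₀ (w.pos n), mul_comm]
    exact weight_mul_norm_apply_le f n

@[simp] theorem coord_apply (n : ℕ+) (f : WeightedL1 𝕜 w) : coord n f = f n := rfl

theorem unit_apply (n k : ℕ+) : (unit w n : WeightedL1 𝕜 w) k = if k = n then 1 else 0 := by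
  simp [unit, Pi.single_apply]

theorem norm_unit (n : ℕ+) : ‖(unit w n : WeightedL1 𝕜 w)‖ = w n := by
  rw [norm_def, tsum_eq_single n]
  · simp [unit_apply]
  · intro k hk
    simp [unit_apply, hk]

/-- Multiplication by the weight is an isometry onto `lp _ 1`. -/
instance : CompleteSpace (WeightedL1 𝕜 w) := by
  let e : WeightedL1 𝕜 w → lp (fun _ : ℕ+ => 𝕜) 1 := fun f =>
    ⟨fun n => (w n : 𝕜) * f n, memℓp_gen (by
      simpa [abs_of_pos (w.pos _)] using f.summable)⟩
  have he : ∀ f g : WeightedL1 𝕜 w, dist (e f) (e g) = dist f g := by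
    intro f g
    rw [dist_eq_norm, dist_eq_norm, lp.norm_eq_tsum_rpow (by simp), norm_def]
    simp only [ENNReal.toReal_one, Real.rpow_one, div_one]
    refine tsum_congr fun n => ?_
    have : (e f - e g : lp (fun _ : ℕ+ => 𝕜) 1) n = (w n : 𝕜) * (f - g) n := by
      change (w n : 𝕜) * f n - (w n : 𝕜) * g n = _
      rw [sub_apply, mul_sub]
    rw [this, norm_mul, RCLike.norm_ofReal, abs_of_pos (w.pos n)]
  have hiso : Isometry e := Isometry.of_dist_eq he
  refine (hiso.isUniformInducing.completeSpace_congr fun g => ?_).2 inferInstance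
  have hg : Summable fun n => ‖g n‖ := by
    simpa using (lp.memℓp g).summable (by simp)
  have hw' : ∀ n, (w n : 𝕜) ≠ 0 := fun n => by exact_mod_cast (w.pos n).ne'
  refine ⟨mk (fun n => (w n : 𝕜)⁻¹ * g n) (hg.congr fun n => ?_), ?_⟩
  · rw [norm_mul, norm_inv, RCLike.norm_ofReal, abs_of_pos (w.pos n),
      mul_inv_cancel_left₀ (w.pos n).ne']
  · ext n
    change (w n : 𝕜) * ((w n : 𝕜)⁻¹ * g n) = g n
    rw [mul_inv_cancel_left₀ (hw' n)]

theorem hasSum_unit (f : WeightedL1 𝕜 w) : HasSum (fun n => f n • unit w n) f := by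
  have hs : Summable fun n => f n • (unit w n : WeightedL1 𝕜 w) := by
    refine Summable.of_norm (f.summable.congr fun n => ?_)
    rw [norm_smul, norm_unit, mul_comm]
  have h : ∑' n, f n • (unit w n : WeightedL1 𝕜 w) = f := by
    ext k
    have h1 := (coord k).hasSum hs.hasSum
    rw [← coord_apply k, h1.tsum_eq.symm, tsum_eq_single k]
    · simp [unit_apply]
    · intro n hn
      simp [unit_apply, hn.symm]
  have := hs.hasSum
  rwa [h] at this

theorem mem_of_unit_mem {K : Submodule 𝕜 (WeightedL1 𝕜 w)}
    (hK : IsClosed (K : Set (WeightedL1 𝕜 w))) (h : ∀ n, unit w n ∈ K) (f : WeightedL1 𝕜 w) :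
    f ∈ K :=
  K.mem_of_hasSum hK (hasSum_unit f) fun n => K.smul_mem _ (h n)

/-! ### Bounded operators determined by their values on unit sequences -/

section Lift

variable {E : Type*} [NormedAddCommGroup E] [NormedSpace 𝕜 E]

theorem clm_ext {L M : WeightedL1 𝕜 w →L[𝕜] E} (h : ∀ n, L (unit w n) = M (unit w n)) :
    L = M := by
  ext f
  have h1 := L.hasSum (hasSum_unit f)
  have h2 := M.hasSum (hasSum_unit f)
  simp only [map_smul, h] at h1 h2
  exact h1.unique h2

theorem summable_norm_mul {E : Type*} [NormedAddCommGroup E] {C : ℝ} {v : ℕ+ → E}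
    (hv : ∀ n, ‖v n‖ ≤ C * w n) (f : WeightedL1 𝕜 w) : Summable fun n => ‖f n‖ * ‖v n‖ := by
  refine Summable.of_nonneg_of_le (fun n => by positivity) (fun n => ?_) (f.summable.mul_left C)
  calc _ ≤ ‖f n‖ * (C * w n) := by gcongr; exact hv n
    _ = _ := by ring

/-- Keeping the series, rather than an operator-norm bound, allows dominated convergence later. -/
theorem norm_map_le_tsum (L : WeightedL1 𝕜 w →L[𝕜] E) (f : WeightedL1 𝕜 w) :
    ‖L f‖ ≤ ∑' n, ‖f n‖ * ‖L (unit w n)‖ := by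
  have h1 := L.hasSum (hasSum_unit f)
  have h2 : Summable fun n => ‖f n‖ * ‖L (unit w n)‖ :=
    summable_norm_mul (C := ‖L‖) (fun n => by
      simpa [norm_unit] using L.le_opNorm (unit w n)) f
  refine h1.norm_le_of_bounded h2.hasSum fun n => ?_
  rw [map_smul, norm_smul]

theorem norm_map_le_of_unit (L : WeightedL1 𝕜 w →L[𝕜] E) {C : ℝ}
    (h : ∀ n, ‖L (unit w n)‖ ≤ C * w n) (f : WeightedL1 𝕜 w) : ‖L f‖ ≤ C * ‖f‖ := by
  refine (norm_map_le_tsum L f).trans ?_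
  rw [norm_def, ← tsum_mul_left]
  refine (summable_norm_mul h f).tsum_le_tsum (fun n => ?_) (f.summable.mul_left C)
  calc _ ≤ ‖f n‖ * (C * w n) := by gcongr; exact h n
    _ = _ := by ring

theorem summable_smul [CompleteSpace E] {C : ℝ} {v : ℕ+ → E} (hv : ∀ n, ‖v n‖ ≤ C * w n)
    (f : WeightedL1 𝕜 w) : Summable fun n => f n • v n :=
  Summable.of_norm ((summable_norm_mul hv f).congr fun _ => (norm_smul _ _).symm)

/-- The continuous linear map with prescribed values on the unit sequences. -/
noncomputable def lift [CompleteSpace E] {C : ℝ} (v : ℕ+ → E) (hv : ∀ n, ‖v n‖ ≤ C * w n) :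
    WeightedL1 𝕜 w →L[𝕜] E :=
  LinearMap.mkContinuous
    { toFun := fun f => ∑' n, f n • v n
      map_add' := fun f g => by
        simp only [add_apply, add_smul]
        exact (summable_smul hv f).tsum_add (summable_smul hv g)
      map_smul' := fun c f => by
        simp only [smul_apply, mul_smul, RingHom.id_apply]
        exact (summable_smul hv f).tsum_const_smul c } C fun f => by
    refine tsum_of_norm_bounded (f.summable.hasSum.mul_left C) fun n => ?_
    rw [norm_smul]
    calc _ ≤ ‖f n‖ * (C * w n) := by gcongr; exact hv n
      _ = _ := by ring

theorem lift_apply [CompleteSpace E] {C : ℝ} (v : ℕ+ → E) (hv : ∀ n, ‖v n‖ ≤ C * w n)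
    (f : WeightedL1 𝕜 w) : lift v hv f = ∑' n, f n • v n := rfl

@[simp] theorem lift_unit [CompleteSpace E] {C : ℝ} (v : ℕ+ → E) (hv : ∀ n, ‖v n‖ ≤ C * w n)
    (n : ℕ+) : lift v hv (unit w n : WeightedL1 𝕜 w) = v n := by
  rw [lift_apply, tsum_eq_single n]
  · simp [unit_apply]
  · intro k hk
    simp [unit_apply, hk]

end Lift

/-- The mass as a continuous linear functional. -/
theorem exists_massCLM (hw : ∀ n : ℕ+, ((n : ℕ) : ℝ) ≤ w n) :
    ∃ M : WeightedL1 𝕜 w →L[𝕜] 𝕜, (∀ f, M f = f.mass) ∧ ∀ n : ℕ+, M (unit w n) = ((n : ℕ) : 𝕜) := by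
  have hv : ∀ n : ℕ+, ‖((n : ℕ) : 𝕜)‖ ≤ 1 * w n := fun n => by
    simpa using hw n
  refine ⟨lift _ hv, fun f => ?_, fun n => lift_unit _ hv n⟩
  rw [lift_apply, mass]
  exact tsum_congr fun n => by rw [smul_eq_mul, mul_comm]

end WeightedL1

/-! ### The operator `A + B` on its core -/

section Operator

variable {𝕜 : Type*} [RCLike 𝕜] {a : ℕ+ → ℝ} {b : ℕ+ → ℕ+ → ℝ} {w : Weight}

open WeightedL1

/-- The image of `e_n` under `A + B`. -/
noncomputable def fragmentationColumn (𝕜 : Type*) [RCLike 𝕜] (a : ℕ+ → ℝ) (b : ℕ+ → ℕ+ → ℝ)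
    (w : Weight) (n : ℕ+) : WeightedL1 𝕜 w :=
  -(a n) • unit w n + ∑ m ∈ Finset.Ico 1 n, (a n * b m n) • unit w m

theorem sum_smul_unit_apply (hb_zero : ∀ n j, j ≤ n → b n j = 0) (n j : ℕ+) :
    (∑ m ∈ Finset.Ico 1 j, b m j • (unit w m : WeightedL1 𝕜 w)) n = (b n j : 𝕜) := by
  rw [← coord_apply n, map_sum]
  simp only [coord_apply, real_smul_apply, unit_apply, mul_ite, mul_one, mul_zero]
  rw [Finset.sum_ite_eq]
  split_ifs with h
  · rfl
  · rw [hb_zero n j (by simpa using h), RCLike.ofReal_zero]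

theorem norm_sum_smul_unit_le (hb : ∀ n j, 0 ≤ b n j)
    (hw_gen : ∀ j : ℕ+, ∑ n ∈ Finset.Ico 1 j, w n * b n j ≤ w j) (j : ℕ+) :
    ‖∑ m ∈ Finset.Ico 1 j, b m j • (unit w m : WeightedL1 𝕜 w)‖ ≤ w j := by
  refine (norm_sum_le_of_le _ fun m _ => ?_).trans (hw_gen j)
  rw [norm_smul, norm_unit, Real.norm_of_nonneg (hb m j), mul_comm]

/-- By (1) the vectors `v_j = ∑_{m<j} b_{m,j} e_m` have norm at most `w_j`. If `Af ∈ ℓ¹_w`, then `∑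
a_j f_j v_j` therefore converges absolutely, and its coordinates are those of `Bf`. Thus `D(A) ⊆
D(B)`, and `A+B` acts columnwise. -/
theorem exists_gainOp_hasSum (hb : ∀ n j, 0 ≤ b n j) (hb_zero : ∀ n j, j ≤ n → b n j = 0)
    (hw_gen : ∀ j : ℕ+, ∑ n ∈ Finset.Ico 1 j, w n * b n j ≤ w j)
    {f : WeightedL1 𝕜 w} (hf : f ∈ (lossOp 𝕜 a w).domain) :
    ∃ hf' : f ∈ (gainOp 𝕜 a b w).domain,
      HasSum (fun n => f n • fragmentationColumn 𝕜 a b w n)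
        (lossOp 𝕜 a w ⟨f, hf⟩ + gainOp 𝕜 a b w ⟨f, hf'⟩) := by
  set h : WeightedL1 𝕜 w := lossOp 𝕜 a w ⟨f, hf⟩ with hh
  have h_apply : ∀ n, h n = -(a n : 𝕜) * f n := fun n => rfl
  set v : ℕ+ → WeightedL1 𝕜 w := fun j => ∑ m ∈ Finset.Ico 1 j, b m j • unit w m with hv
  have hvb : ∀ j, ‖v j‖ ≤ 1 * w j := fun j => by
    rw [one_mul]; exact norm_sum_smul_unit_le hb hw_gen j
  obtain ⟨g, hg⟩ := summable_smul hvb (-h)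
  have hcoord : ∀ n, HasSum (fun j : Set.Ioi n => ((a j * b n j : ℝ) : 𝕜) * f j) (g n) := by
    intro n
    have h1 := (coord n).hasSum hg
    have h2 : HasSum (fun j => ((a j * b n j : ℝ) : 𝕜) * f j) (g n) := by
      refine h1.congr_fun ?_
      intro j
      rw [map_smul, coord_apply, sum_smul_unit_apply hb_zero, WeightedL1.neg_apply, h_apply, smul_eq_mul]
      push_cast
      ring
    refine (hasSum_subtype_iff_of_support_subset (s := Set.Ioi n) fun j hj => ?_).2 h2
    by_contra hn
    exact hj (by simp [hb_zero n j (not_lt.1 hn)])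
  have hf' : f ∈ (gainOp 𝕜 a b w).domain := by
    refine ⟨fun n => (hcoord n).summable, ?_⟩
    convert g.2 using 1
    funext n
    exact (hcoord n).tsum_eq
  refine ⟨hf', ?_⟩
  have hgain : gainOp 𝕜 a b w ⟨f, hf'⟩ = g := by
    ext n
    exact (hcoord n).tsum_eq
  rw [hgain]
  refine ((hasSum_unit h).add hg).congr_fun fun n => ?_
  ext k
  simp only [fragmentationColumn, hv, WeightedL1.smul_apply, WeightedL1.add_apply, real_smul_apply,
    h_apply, WeightedL1.neg_apply,
    mul_smul, ← Finset.smul_sum]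
  push_cast
  ring

/-- The finite sequences form a core: a closed subspace contains the graph once it contains the
pairs over the `e_n`. -/
theorem hasSum_of_mem_graph (hb : ∀ n j, 0 ≤ b n j) (hb_zero : ∀ n j, j ≤ n → b n j = 0)
    (hw_gen : ∀ j : ℕ+, ∑ n ∈ Finset.Ico 1 j, w n * b n j ≤ w j)
    {x : WeightedL1 𝕜 w × WeightedL1 𝕜 w} (hx : x ∈ (lossOp 𝕜 a w + gainOp 𝕜 a b w).graph) :
    HasSum (fun n => x.1 n • (unit w n, fragmentationColumn 𝕜 a b w n)) x := by
  obtain ⟨y, hy⟩ := (LinearPMap.mem_graph_iff' _).1 hx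
  subst hy
  obtain ⟨h, hs⟩ := exists_gainOp_hasSum (a := a) hb hb_zero hw_gen y.2.1
  exact (hasSum_unit y.1).prodMk hs

theorem unit_mem_graph (hb : ∀ n j, 0 ≤ b n j) (hb_zero : ∀ n j, j ≤ n → b n j = 0)
    (hw_gen : ∀ j : ℕ+, ∑ n ∈ Finset.Ico 1 j, w n * b n j ≤ w j) (n : ℕ+) :
    (unit w n, fragmentationColumn 𝕜 a b w n) ∈ (lossOp 𝕜 a w + gainOp 𝕜 a b w).graph := by
  have h1 : (unit w n : WeightedL1 𝕜 w) ∈ (lossOp 𝕜 a w).domain := by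
    change Summable _
    refine summable_of_ne_finset_zero (s := {n}) fun k hk => ?_
    have : k ≠ n := by simpa using hk
    simp [unit_apply, this]
  obtain ⟨h2, hs⟩ := exists_gainOp_hasSum (a := a) hb hb_zero hw_gen h1
  have hs' : HasSum (fun k => (unit w n : WeightedL1 𝕜 w) k • fragmentationColumn 𝕜 a b w k)
      (fragmentationColumn 𝕜 a b w n) := by
    convert hasSum_single n fun k hk => ?_ using 1
    · simp [unit_apply]
    · simp [unit_apply, hk]
  rw [hs'.unique hs]
  exact LinearPMap.mem_graph (lossOp 𝕜 a w + gainOp 𝕜 a b w) ⟨unit w n, h1, h2⟩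

end Operator

/-! ### Semigroups and generators -/

namespace C0Semigroup

variable {𝕜 X : Type*} [RCLike 𝕜] [NormedAddCommGroup X] [NormedSpace 𝕜 X]

theorem ext_op {S T : C0Semigroup 𝕜 X} (h : ∀ t, S.op t = T.op t) : S = T := by
  cases S
  cases T
  congr
  exact funext h

/-- The generator of `S` as a relation. -/
def GeneratorRel (S : C0Semigroup 𝕜 X) (x y : X) : Prop :=
  Tendsto (fun t : ℝ≥0 => (((t : ℝ)⁻¹ : ℝ) : 𝕜) • (S.op t x - x)) (𝓝[>] 0) (𝓝 y)

variable (S : C0Semigroup 𝕜 X)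

theorem GeneratorRel.sub {x y x' y' : X} (h : S.GeneratorRel x y) (h' : S.GeneratorRel x' y') :
    S.GeneratorRel (x - x') (y - y') := by
  refine (Tendsto.sub h h').congr fun t => ?_
  rw [← smul_sub, map_sub]
  congr 1
  abel

/-- Generators of contraction semigroups are dissipative. -/
theorem GeneratorRel.norm_le_norm_sub (hS : ∀ t x, ‖S.op t x‖ ≤ ‖x‖) {x y : X}
    (h : S.GeneratorRel x y) : ‖x‖ ≤ ‖x - y‖ := by
  have hlim := (tendsto_const_nhds (x := x)).sub h |>.norm
  refine ge_of_tendsto hlim ?_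
  filter_upwards [self_mem_nhdsWithin] with t ht
  have ht' : (0 : ℝ) < (t : ℝ)⁻¹ := inv_pos.2 (by exact_mod_cast ht)
  set r := (t : ℝ)⁻¹
  -- By contractivity the right side has norm at least `(1 + r)‖x‖ - r‖x‖ = ‖x‖`.
  have h1 : x - (r : 𝕜) • (S.op t x - x) = ((1 + r : ℝ) : 𝕜) • x - (r : 𝕜) • S.op t x := by
    push_cast
    module
  rw [h1]
  have h2 := norm_sub_norm_le (((1 + r : ℝ) : 𝕜) • x) ((r : 𝕜) • S.op t x)
  rw [norm_smul, norm_smul, RCLike.norm_ofReal, RCLike.norm_ofReal, abs_of_pos ht',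
    abs_of_pos (by linarith)] at h2
  have h3 := mul_le_mul_of_nonneg_left (hS t x) ht'.le
  linarith

theorem continuous_op_toNNReal (x : X) : Continuous fun t : ℝ => S.op t.toNNReal x :=
  (S.strongly_continuous x).comp continuous_real_toNNReal

variable [NormedSpace ℝ X] [IsScalarTower ℝ 𝕜 X]

/-- By the semigroup law the forward slope at `t` is `S(t)` applied to a slope at `0`. Only right
derivatives come for free, and the comparison principle asks for no more. -/
theorem GeneratorRel.hasDerivWithinAt {x y : X} (h : S.GeneratorRel x y) {t : ℝ} (ht : 0 ≤ t) :
    HasDerivWithinAt (fun t : ℝ => S.op t.toNNReal x) (S.op t.toNNReal y) (Set.Ici t) t := by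
  rw [← hasDerivWithinAt_Ioi_iff_Ici, hasDerivWithinAt_iff_tendsto_slope' (by simp)]
  have h1 : Tendsto (fun s : ℝ => (s - t).toNNReal) (𝓝[>] t) (𝓝[>] 0) := by
    refine tendsto_nhdsWithin_iff.2 ⟨?_, ?_⟩
    · have : Continuous fun s : ℝ => (s - t).toNNReal := by fun_prop
      simpa using (this.tendsto t).mono_left nhdsWithin_le_nhds
    · filter_upwards [self_mem_nhdsWithin] with s hs
      exact Real.toNNReal_pos.2 (sub_pos.2 hs)
  have h2 := (((S.op t.toNNReal).continuous.tendsto y).comp h).comp h1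
  refine h2.congr' ?_
  filter_upwards [self_mem_nhdsWithin] with s hs
  have hst : 0 ≤ s - t := (sub_pos.2 hs).le
  have hop : S.op s.toNNReal = (S.op t.toNNReal).comp (S.op (s - t).toNNReal) := by
    rw [← S.op_add, ← Real.toNNReal_add ht hst, add_sub_cancel]
  simp only [Function.comp_apply, slope_def_module, map_smul, map_sub, Real.coe_toNNReal _ hst, hop,
    ContinuousLinearMap.comp_apply]
  rw [RCLike.real_smul_eq_coe_smul (K := 𝕜)]

/-- The pairs `(x, y)` with `S(t) x - x = ∫₀ᵗ S(s) y ds` for all `t ≥ 0`. -/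
def integratedGenerator : Submodule 𝕜 (X × X) where
  carrier := {z | ∀ t : ℝ≥0, S.op t z.1 - z.1 = ∫ s in (0 : ℝ)..t, S.op s.toNNReal z.2}
  zero_mem' := by simp
  add_mem' := by
    intro z z' hz hz' t
    simp only [Prod.fst_add, Prod.snd_add, map_add]
    rw [intervalIntegral.integral_add ((S.continuous_op_toNNReal _).intervalIntegrable _ _)
      ((S.continuous_op_toNNReal _).intervalIntegrable _ _), ← hz t, ← hz' t]
    abel
  smul_mem' := by
    intro c z hz t
    have : SMulCommClass ℝ 𝕜 X := IsScalarTower.to_smulCommClass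
    simp only [Prod.smul_fst, Prod.smul_snd, map_smul]
    rw [intervalIntegral.integral_smul, ← hz t, smul_sub]

theorem mem_integratedGenerator {x y : X} : (x, y) ∈ S.integratedGenerator ↔
    ∀ t : ℝ≥0, S.op t x - x = ∫ s in (0 : ℝ)..t, S.op s.toNNReal y := Iff.rfl

/-- For a contraction semigroup the integral is `t`-Lipschitz in `y`, so each defining equation is
closed. This is the advantage of the integrated relation over difference quotients. -/
theorem isClosed_integratedGenerator (hS : ∀ t x, ‖S.op t x‖ ≤ ‖x‖) :
    IsClosed (S.integratedGenerator : Set (X × X)) := by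
  have : (S.integratedGenerator : Set (X × X)) =
      ⋂ t : ℝ≥0, {z | S.op t z.1 - z.1 = ∫ s in (0 : ℝ)..t, S.op s.toNNReal z.2} := by
    ext z
    simp only [Set.mem_iInter]
    exact Iff.rfl
  rw [this]
  refine isClosed_iInter fun t => isClosed_eq (by fun_prop) ?_
  refine Continuous.comp (g := fun y => ∫ s in (0 : ℝ)..t, S.op s.toNNReal y) ?_ continuous_snd
  refine (LipschitzWith.of_dist_le_mul (K := t) fun y y' => ?_).continuous
  rw [dist_eq_norm, dist_eq_norm, ← intervalIntegral.integral_sub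
    ((S.continuous_op_toNNReal _).intervalIntegrable _ _)
    ((S.continuous_op_toNNReal _).intervalIntegrable _ _)]
  refine (intervalIntegral.norm_integral_le_of_norm_le_const (C := ‖y - y'‖) fun s _ => ?_).trans ?_
  · rw [← map_sub]
    exact hS _ _
  · simp [mul_comm]

theorem generatorRel_of_mem_integratedGenerator [CompleteSpace X] {x y : X} (h : (x, y) ∈ S.integratedGenerator) :
    S.GeneratorRel x y := by
  have hc := S.continuous_op_toNNReal y
  have h1 := intervalIntegral.integral_hasDerivAt_right (hc.intervalIntegrable 0 0)
    (hc.stronglyMeasurableAtFilter _ _) hc.continuousAt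
  have h2 := h1.hasDerivWithinAt (s := Set.Ioi 0)
  rw [hasDerivWithinAt_iff_tendsto_slope' (by simp)] at h2
  simp only [Real.toNNReal_zero, S.op_zero, ContinuousLinearMap.id_apply] at h2
  have h3 : Tendsto (fun t : ℝ≥0 => (t : ℝ)) (𝓝[>] 0) (𝓝[>] 0) := by
    refine tendsto_nhdsWithin_iff.2 ⟨?_, ?_⟩
    · exact (NNReal.continuous_coe.tendsto 0).mono_left nhdsWithin_le_nhds
    · filter_upwards [self_mem_nhdsWithin] with t ht
      exact_mod_cast ht
  refine (h2.comp h3).congr fun t => ?_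
  simp only [Function.comp_apply, slope_def_module, intervalIntegral.integral_same, sub_zero]
  rw [← (S.mem_integratedGenerator.1 h) t, RCLike.real_smul_eq_coe_smul (K := 𝕜)]

end C0Semigroup

/-! ### The fragmentation semigroup -/

section Fragmentation

open WeightedL1

variable {𝕜 : Type*} [RCLike 𝕜] {a : ℕ+ → ℝ} {b : ℕ+ → ℕ+ → ℝ} {w : Weight}

theorem map_fragmentationColumn (L : WeightedL1 𝕜 w →L[𝕜] WeightedL1 𝕜 w) (n : ℕ+) :
    L (fragmentationColumn 𝕜 a b w n) =
      -(a n) • L (unit w n) + ∑ m ∈ Finset.Ico 1 n, (a n * b m n) • L (unit w m) := by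
  have hr : ∀ (c : ℝ) (f : WeightedL1 𝕜 w), L (c • f) = c • L f := fun c f => by
    rw [RCLike.real_smul_eq_coe_smul (K := 𝕜), map_smul, ← RCLike.real_smul_eq_coe_smul]
  simp only [fragmentationColumn, map_add, map_sum, hr]

theorem C0Semigroup.isFragmentationFlow {S : C0Semigroup 𝕜 (WeightedL1 𝕜 w)}
    (h : ∀ n, S.GeneratorRel (unit w n) (fragmentationColumn 𝕜 a b w n)) :
    IsFragmentationFlow a b fun n (t : ℝ) => S.op t.toNNReal (unit w n) where
  continuousOn n := (S.continuous_op_toNNReal _).continuousOn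
  hasDeriv n t ht := by
    refine ((h n).hasDerivWithinAt S ht).congr_deriv ?_
    rw [map_fragmentationColumn]

/-- Both semigroups give flows starting at `e_n`, and the triangular system has only one. -/
theorem C0Semigroup.eq_of_generatorRel {S T : C0Semigroup 𝕜 (WeightedL1 𝕜 w)}
    (hS : ∀ n, S.GeneratorRel (unit w n) (fragmentationColumn 𝕜 a b w n))
    (hT : ∀ n, T.GeneratorRel (unit w n) (fragmentationColumn 𝕜 a b w n)) : S = T := by
  refine C0Semigroup.ext_op fun t => clm_ext fun n => ?_
  have := (C0Semigroup.isFragmentationFlow hS).eq_of_eq_zero (C0Semigroup.isFragmentationFlow hT)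
    (fun n => by simp [S.op_zero, T.op_zero]) n t t.2
  simpa using this

theorem norm_fragmentationFlow_unit_le (ha : ∀ n, 0 ≤ a n) (hb : ∀ n j, 0 ≤ b n j)
    (hw_gen : ∀ j : ℕ+, ∑ n ∈ Finset.Ico 1 j, w n * b n j ≤ w j) (n : ℕ+) {t : ℝ} (ht : 0 ≤ t) :
    ‖fragmentationFlow a b (fun n => (unit w n : WeightedL1 𝕜 w)) n t‖ ≤ 1 * w n := by
  have := (isFragmentationFlow_fragmentationFlow a b
    (fun n => (unit w n : WeightedL1 𝕜 w))).norm_le ha hb (c := w) (κ := 1) (β := 0) (C := 1)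
    zero_le_one (fun n => (w.pos n).le) (by simpa using hw_gen) (fun n => Or.inl (by simp))
    (fun n => by rw [fragmentationFlow_zero, norm_unit, one_mul]) n t ht
  simpa using this

/-- The fragmentation semigroup, given on `e_n` by the fragmentation flow. -/
noncomputable def fragmentationSemigroup (𝕜 : Type*) [RCLike 𝕜]
    (ha : ∀ n, 0 ≤ a n) (hb : ∀ n j, 0 ≤ b n j)
    (hw_gen : ∀ j : ℕ+, ∑ n ∈ Finset.Ico 1 j, w n * b n j ≤ w j) :
    C0Semigroup 𝕜 (WeightedL1 𝕜 w) where
  op t := lift (fun n => fragmentationFlow a b (fun n => unit w n) n t) fun n =>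
    norm_fragmentationFlow_unit_le ha hb hw_gen n t.2
  op_zero := clm_ext fun n => by simp [fragmentationFlow_zero]
  op_add s t := by
    refine clm_ext fun n => ?_
    set p := fragmentationFlow a b (fun n => (unit w n : WeightedL1 𝕜 w)) with hp
    have hflow : IsFragmentationFlow a b p := isFragmentationFlow_fragmentationFlow a b _
    set L : WeightedL1 𝕜 w →L[𝕜] WeightedL1 𝕜 w := lift (fun n => p n s) fun n =>
      norm_fragmentationFlow_unit_le ha hb hw_gen n s.2 with hL
    -- The semigroup law is uniqueness of flows: `p_n(· + s)` and `L p_n(·)`, with `L` the operator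
    -- at time `s`, both start at `p_n(s)`.
    have h := (hflow.comp_add s.2).eq_of_eq_zero (hflow.map (L.restrictScalars ℝ))
      (fun n => by simp [hp, fragmentationFlow_zero, hL]) n t t.2
    simp only [ContinuousLinearMap.comp_apply, lift_unit]
    simpa [add_comm] using h
  strongly_continuous f := by
    simp only [lift_apply]
    refine continuous_tsum (u := fun n => w n * ‖f n‖) (fun n => ?_) f.summable fun n t => ?_
    · exact ((continuous_fragmentationFlow a b _ n).comp NNReal.continuous_coe).const_smul (f n)
    · rw [norm_smul, mul_comm]
      have := norm_fragmentationFlow_unit_le (𝕜 := 𝕜) ha hb hw_gen n t.2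
      rw [one_mul] at this
      exact mul_le_mul_of_nonneg_right this (norm_nonneg _)

variable (ha : ∀ n, 0 ≤ a n) (hb : ∀ n j, 0 ≤ b n j)
  (hw_gen : ∀ j : ℕ+, ∑ n ∈ Finset.Ico 1 j, w n * b n j ≤ w j)

theorem fragmentationSemigroup_unit (t : ℝ≥0) (n : ℕ+) :
    (fragmentationSemigroup 𝕜 ha hb hw_gen).op t (unit w n) =
      fragmentationFlow a b (fun n => unit w n) n t :=
  lift_unit _ (fun n => norm_fragmentationFlow_unit_le ha hb hw_gen n t.2) n

theorem norm_fragmentationSemigroup_le (t : ℝ≥0) (f : WeightedL1 𝕜 w) :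
    ‖(fragmentationSemigroup 𝕜 ha hb hw_gen).op t f‖ ≤ ‖f‖ := by
  have := norm_map_le_of_unit ((fragmentationSemigroup 𝕜 ha hb hw_gen).op t) (C := 1) (fun n => by
    rw [fragmentationSemigroup_unit]
    exact norm_fragmentationFlow_unit_le ha hb hw_gen n t.2) f
  simpa using this

theorem unit_mem_integratedGenerator (n : ℕ+) :
    (unit w n, fragmentationColumn 𝕜 a b w n) ∈
      (fragmentationSemigroup 𝕜 ha hb hw_gen).integratedGenerator := by
  set S := fragmentationSemigroup 𝕜 ha hb hw_gen with hS
  set p := fragmentationFlow a b (fun n => (unit w n : WeightedL1 𝕜 w)) with hp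
  have hflow : IsFragmentationFlow a b p := isFragmentationFlow_fragmentationFlow a b _
  have hSp : ∀ m (s : ℝ), 0 ≤ s → S.op s.toNNReal (unit w m) = p m s := fun m s hs => by
    rw [hS, fragmentationSemigroup_unit, Real.coe_toNNReal _ hs]
  rw [C0Semigroup.mem_integratedGenerator]
  intro t
  have ht : (0 : ℝ) ≤ t := t.2
  rw [intervalIntegral.integral_eq_sub_of_hasDeriv_right (f := p n)
    (continuous_fragmentationFlow a b _ n).continuousOn ?_
    ((S.continuous_op_toNNReal _).intervalIntegrable _ _)]
  · rw [← hSp n t ht, ← hSp n 0 le_rfl]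
    simp [S.op_zero]
  · intro s hs
    rw [min_eq_left ht] at hs
    refine ((hasDerivWithinAt_Ioi_iff_Ici.2 (hflow.hasDeriv n s hs.1.le))).congr_deriv ?_
    rw [map_fragmentationColumn, hSp n s hs.1.le]
    congr 1
    exact Finset.sum_congr rfl fun m _ => by rw [hSp m s hs.1.le]

theorem closure_graph_le_integratedGenerator (ha : ∀ n, 0 ≤ a n) (hb : ∀ n j, 0 ≤ b n j)
    (hw_gen : ∀ j : ℕ+, ∑ n ∈ Finset.Ico 1 j, w n * b n j ≤ w j)
    (hb_zero : ∀ n j, j ≤ n → b n j = 0) :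
    (lossOp 𝕜 a w + gainOp 𝕜 a b w).graph.topologicalClosure ≤
      (fragmentationSemigroup 𝕜 ha hb hw_gen).integratedGenerator := by
  have hc := C0Semigroup.isClosed_integratedGenerator _
    (norm_fragmentationSemigroup_le (𝕜 := 𝕜) ha hb hw_gen)
  refine Submodule.topologicalClosure_minimal _ (fun x hx => ?_) hc
  exact Submodule.mem_of_hasSum _ hc (hasSum_of_mem_graph hb hb_zero hw_gen hx)
    fun n => Submodule.smul_mem _ _ (unit_mem_integratedGenerator ha hb hw_gen n)

/-- A pair `(0, y)` in the closed graph satisfies the generator relation, whose difference quotients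
at `0` vanish; so `y = 0`. -/
theorem isClosable_fragmentation (ha : ∀ n, 0 ≤ a n) (hb : ∀ n j, 0 ≤ b n j)
    (hw_gen : ∀ j : ℕ+, ∑ n ∈ Finset.Ico 1 j, w n * b n j ≤ w j)
    (hb_zero : ∀ n j, j ≤ n → b n j = 0) :
    (lossOp 𝕜 a w + gainOp 𝕜 a b w).IsClosable := by
  refine ⟨(lossOp 𝕜 a w + gainOp 𝕜 a b w).graph.topologicalClosure.toLinearPMap, ?_⟩
  rw [Submodule.toLinearPMap_graph_eq]
  rintro ⟨x, y⟩ hx (rfl : x = 0)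
  have h := C0Semigroup.generatorRel_of_mem_integratedGenerator _
    (closure_graph_le_integratedGenerator ha hb hw_gen hb_zero hx)
  have h0 : Tendsto (fun _ : ℝ≥0 => (0 : WeightedL1 𝕜 w)) (𝓝[>] 0) (𝓝 y) := by
    simpa [C0Semigroup.GeneratorRel] using h
  exact (tendsto_nhds_unique h0 tendsto_const_nhds)

/-- `1 - (A + B)` is onto after taking closures. -/
theorem exists_mem_closure_graph (ha : ∀ n, 0 ≤ a n) (hb : ∀ n j, 0 ≤ b n j)
    (hw_gen : ∀ j : ℕ+, ∑ n ∈ Finset.Ico 1 j, w n * b n j ≤ w j)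
    (hb_zero : ∀ n j, j ≤ n → b n j = 0)
    (g : WeightedL1 𝕜 w) : ∃ f, (f, f - g) ∈
    (lossOp 𝕜 a w + gainOp 𝕜 a b w).graph.topologicalClosure := by
  set K := (lossOp 𝕜 a w + gainOp 𝕜 a b w).graph.topologicalClosure with hK
  have hunit : ∀ n, (unit w n, fragmentationColumn 𝕜 a b w n) ∈ K := fun n =>
    Submodule.le_topologicalClosure _ (unit_mem_graph hb hb_zero hw_gen n)
  have hreal : ∀ (c : ℝ) z, z ∈ K → c • z ∈ K := fun c z hz => by
    have := K.smul_mem (c : 𝕜) hz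
    rwa [← RCLike.real_smul_eq_coe_smul] at this
  -- The resolvent at `e_n` is found recursively from `(1 + a_n) r_n = e_n + ∑_{m<n} a_n b_{m,n}
  -- r_m`.
  have hex : ∀ n, ∃ f, (f, f - unit w n) ∈ K := by
    intro n
    induction n using PNat.strongInductionOn with
    | _ n ih =>
      choose! r hr using ih
      have hpos : 0 < 1 + a n := by linarith [ha n]
      refine ⟨(1 + a n)⁻¹ • (unit w n + ∑ m ∈ Finset.Ico 1 n, (a n * b m n) • r m), ?_⟩
      have h1 := hreal (1 + a n)⁻¹ _ (K.add_mem (hunit n) (K.sum_mem (t := Finset.Ico 1 n)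
        fun m hm => hreal (a n * b m n) _ (hr m (Finset.mem_Ico.1 hm).2)))
      convert h1 using 1
      refine Prod.ext ?_ ?_
      · simp [Prod.fst_sum]
      · have h2 : (unit w n : WeightedL1 𝕜 w) = (1 + a n)⁻¹ • ((1 + a n) • unit w n) := by
          rw [smul_smul, inv_mul_cancel₀ hpos.ne', one_smul]
        simp only [Prod.smul_snd, Prod.snd_add, Prod.snd_sum, smul_sub, Finset.sum_sub_distrib,
          fragmentationColumn]
        conv_lhs => rw [sub_eq_add_neg]; enter [2]; rw [h2]
        module
  choose r hr using hex
  -- Dissipativity supplies the bound that lets `r` extend to an operator `R` on all of `ℓ¹_w`.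
  have hdiss : ∀ n, ‖r n‖ ≤ 1 * w n := fun n => by
    have := (C0Semigroup.generatorRel_of_mem_integratedGenerator _
      (closure_graph_le_integratedGenerator ha hb hw_gen hb_zero (hr n))).norm_le_norm_sub _
      (norm_fragmentationSemigroup_le (𝕜 := 𝕜) ha hb hw_gen)
    simpa [norm_unit] using this
  set R : WeightedL1 𝕜 w →L[𝕜] WeightedL1 𝕜 w := lift r hdiss
  refine ⟨R g, ?_⟩
  set Φ := R.prod (R - ContinuousLinearMap.id 𝕜 _)
  have hcl : IsClosed ((K.comap Φ.toLinearMap : Submodule 𝕜 _) : Set (WeightedL1 𝕜 w)) :=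
    (Submodule.isClosed_topologicalClosure _).preimage Φ.continuous
  exact mem_of_unit_mem hcl (fun n => by simpa [Φ, R] using hr n) g

/-- The generator extends the closure. It is no larger, since `1` minus the closure is already onto
and `1` minus the generator is injective. -/
theorem hasGenerator_fragmentationSemigroup (ha : ∀ n, 0 ≤ a n) (hb : ∀ n j, 0 ≤ b n j)
    (hw_gen : ∀ j : ℕ+, ∑ n ∈ Finset.Ico 1 j, w n * b n j ≤ w j)
    (hb_zero : ∀ n j, j ≤ n → b n j = 0) :
    (fragmentationSemigroup 𝕜 ha hb hw_gen).HasGenerator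
      (lossOp 𝕜 a w + gainOp 𝕜 a b w).closure := by
  intro x y
  rw [← (isClosable_fragmentation ha hb hw_gen hb_zero).graph_closure_eq_closure_graph]
  have hle : ∀ {x y}, (x, y) ∈ (lossOp 𝕜 a w + gainOp 𝕜 a b w).graph.topologicalClosure →
      (fragmentationSemigroup 𝕜 ha hb hw_gen).GeneratorRel x y := fun h =>
    C0Semigroup.generatorRel_of_mem_integratedGenerator _
      (closure_graph_le_integratedGenerator ha hb hw_gen hb_zero h)
  refine ⟨hle, fun h => ?_⟩
  obtain ⟨f, hf⟩ := exists_mem_closure_graph ha hb hw_gen hb_zero (x - y)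
  have hz := C0Semigroup.GeneratorRel.norm_le_norm_sub _
    (norm_fragmentationSemigroup_le ha hb hw_gen) (C0Semigroup.GeneratorRel.sub _ h (hle hf))
  have h0 : x - f - (y - (f - (x - y))) = 0 := by abel
  rw [h0, norm_zero] at hz
  have hxf : x = f := sub_eq_zero.1 (norm_le_zero_iff.1 hz)
  subst hxf
  simpa using hf

end Fragmentation

/-! ### Long-time behaviour -/

section Asymptotics

open WeightedL1

variable {𝕜 : Type*} [RCLike 𝕜] {a : ℕ+ → ℝ} {b : ℕ+ → ℕ+ → ℝ} {w : Weight}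
  {S : C0Semigroup 𝕜 (WeightedL1 𝕜 w)}

theorem C0Semigroup.op_unit_one
    (hS : ∀ n, S.GeneratorRel (unit w n) (fragmentationColumn 𝕜 a b w n))
    (ha_one : a 1 = 0) (t : ℝ≥0) : S.op t (unit w 1) = unit w 1 := by
  have := (isFragmentationFlow hS).eq_exp_smul (k := 1) (fun n hn => absurd hn (by simp)) t.2
  simpa [ha_one, S.op_zero] using this

/-- The `n`-th coordinates of `S(t)e_m` form a scalar flow that starts at zero for `m < n`. This
exact value is the source of all lower bounds. -/
theorem C0Semigroup.op_unit_apply_self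
    (hS : ∀ n, S.GeneratorRel (unit w n) (fragmentationColumn 𝕜 a b w n))
    (n : ℕ+) (t : ℝ≥0) :
    (S.op t (unit w n)) n = (Real.exp (-(a n) * t) : 𝕜) := by
  have := ((isFragmentationFlow hS).map ((coord n).restrictScalars ℝ)).eq_exp_smul (k := n)
    (fun m hm => by simp [S.op_zero, unit_apply, hm.ne']) t.2
  simpa [S.op_zero, unit_apply, RCLike.real_smul_eq_coe_mul] using this

/-- The deviation of `S(t) e_n` from the stationary state. -/
theorem C0Semigroup.isFragmentationFlow_deviation
    (hS : ∀ n, S.GeneratorRel (unit w n) (fragmentationColumn 𝕜 a b w n))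
    (ha_one : a 1 = 0)
    (h_mass : ∀ j : ℕ+, 2 ≤ j → ∑ n ∈ Finset.Ico 1 j, ((n : ℕ) : ℝ) * b n j = ((j : ℕ) : ℝ)) :
    IsFragmentationFlow a b fun n (t : ℝ) =>
      S.op t.toNNReal (unit w n) - ((n : ℕ) : ℝ) • unit w 1 :=
  (isFragmentationFlow hS).sub (IsFragmentationFlow.mass_smul ha_one h_mass _)

/-- The constant comes from `‖e_n - n e_1‖ ≤ w_n + n w_1 ≤ (w_1 + 1) w_n`, using `n ≤ w_n`. -/
theorem C0Semigroup.norm_deviation_unit_le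
    (hS : ∀ n, S.GeneratorRel (unit w n) (fragmentationColumn 𝕜 a b w n))
    (ha : ∀ n, 0 ≤ a n) (hb : ∀ n j, 0 ≤ b n j)
    (hw : ∀ n : ℕ+, ((n : ℕ) : ℝ) ≤ w n) (ha_one : a 1 = 0)
    (h_mass : ∀ j : ℕ+, 2 ≤ j → ∑ n ∈ Finset.Ico 1 j, ((n : ℕ) : ℝ) * b n j = ((j : ℕ) : ℝ))
    {κ β : ℝ} (hκ : ∀ j : ℕ+, ∑ n ∈ Finset.Ico 1 j, w n * b n j ≤ κ * w j)
    (hβ : ∀ n : ℕ+, 2 ≤ n → β ≤ (1 - κ) * a n) (n : ℕ+) (t : ℝ≥0) :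
    ‖S.op t (unit w n) - ((n : ℕ) : ℝ) • unit w 1‖ ≤
      (w 1 + 1) * Real.exp (-β * t) * w n := by
  have hw1 := w.pos 1
  have h := (isFragmentationFlow_deviation hS ha_one h_mass).norm_le ha hb (c := w) (C := w 1 + 1)
    (β := β) (by positivity) (fun n => (w.pos n).le) hκ (fun n => ?_) (fun n => ?_) n t t.2
  · rw [Real.toNNReal_coe] at h
    exact h.trans_eq (by ring)
  · rcases eq_or_ne n 1 with rfl | hn
    · exact Or.inr fun t _ => by simp [op_unit_one hS ha_one]
    · exact Or.inl (hβ n (PNat.add_one_le_iff.2 (lt_of_le_of_ne one_le (Ne.symm hn))))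
  · refine (norm_sub_le _ _).trans ?_
    rw [Real.toNNReal_zero, S.op_zero, ContinuousLinearMap.id_apply, norm_unit, norm_smul,
      norm_unit, Real.norm_of_nonneg (Nat.cast_nonneg _)]
    nlinarith [hw n]

end Asymptotics

theorem mainTheorem4 {𝕜 : Type*} [RCLike 𝕜] (a : ℕ+ → ℝ) (b : ℕ+ → ℕ+ → ℝ) (w : Weight)
    (ha : ∀ n, 0 ≤ a n)
    (hb : ∀ n j, 0 ≤ b n j)
    (hb_zero : ∀ n j, j ≤ n → b n j = 0)
    (hw : ∀ n : ℕ+, ((n : ℕ) : ℝ) ≤ w n)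
    (hw_gen : ∃ κ : ℝ, 0 < κ ∧ κ ≤ 1 ∧
      ∀ j : ℕ+, 2 ≤ j → ∑ n ∈ Finset.Ico 1 j, w n * b n j ≤ κ * w j)
    (ha_one : a 1 = 0)
    (h_mass : ∀ j : ℕ+, 2 ≤ j → ∑ n ∈ Finset.Ico 1 j, ((n : ℕ) : ℝ) * b n j = ((j : ℕ) : ℝ)) :
    -- the closure of `A + B` generates exactly one semigroup
    (lossOp 𝕜 a w + gainOp 𝕜 a b w).IsClosable ∧
    (∃! S : C0Semigroup 𝕜 (WeightedL1 𝕜 w),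
      S.HasGenerator (lossOp 𝕜 a w + gainOp 𝕜 a b w).closure) ∧
    ∀ S : C0Semigroup 𝕜 (WeightedL1 𝕜 w),
      S.HasGenerator (lossOp 𝕜 a w + gainOp 𝕜 a b w).closure →
      -- convergence to the monomer state
      ((∀ u : WeightedL1 𝕜 w,
          Tendsto (fun t : ℝ≥0 => ‖S.op t u - u.mass • WeightedL1.unit w 1‖) atTop (𝓝 0)) ↔
        ∀ n : ℕ+, 2 ≤ n → 0 < a n) ∧
      -- rate of convergence
      ∀ κ : ℝ, 0 < κ → κ < 1 →
        (∀ j : ℕ+, 2 ≤ j → ∑ n ∈ Finset.Ico 1 j, w n * b n j ≤ κ * w j) →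
        ∀ a₀ : ℝ, a₀ = ⨅ n : {n : ℕ+ // 2 ≤ n}, a n →
          (∀ (u : WeightedL1 𝕜 w) (t : ℝ≥0),
            ‖S.op t u - u.mass • WeightedL1.unit w 1‖ ≤
              (w 1 + 1) * Real.exp (-(1 - κ) * a₀ * t) * ‖u‖) ∧
          (0 < a₀ → ∀ α : ℝ, 0 ≤ α → α < (1 - κ) * a₀ → ∀ u : WeightedL1 𝕜 w,
            Tendsto (fun t : ℝ≥0 => Real.exp (α * t) *
              ‖S.op t u - u.mass • WeightedL1.unit w 1‖) atTop (𝓝 0)) ∧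
          (∀ α : ℝ, a₀ < α → ¬ ∀ u : WeightedL1 𝕜 w,
            Tendsto (fun t : ℝ≥0 => Real.exp (α * t) *
              ‖S.op t u - u.mass • WeightedL1.unit w 1‖) atTop (𝓝 0)) ∧
          (a₀ = 0 → ∀ α : ℝ, 0 < α → ¬ ∀ u : WeightedL1 𝕜 w,
            Tendsto (fun t : ℝ≥0 => Real.exp (α * t) *
              ‖S.op t u - u.mass • WeightedL1.unit w 1‖) atTop (𝓝 0)) := by
  have hge : ∀ {n : ℕ+}, n ≠ 1 → 2 ≤ n := fun hn =>
    PNat.add_one_le_iff.2 (lt_of_le_of_ne one_le (Ne.symm hn))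
  have hextend : ∀ κ : ℝ, 0 < κ →
      (∀ j : ℕ+, 2 ≤ j → ∑ n ∈ Finset.Ico 1 j, w n * b n j ≤ κ * w j) →
      ∀ j : ℕ+, ∑ n ∈ Finset.Ico 1 j, w n * b n j ≤ κ * w j := by
    intro κ hκ h j
    rcases eq_or_ne j 1 with rfl | hj
    · simpa using (mul_pos hκ (w.pos 1)).le
    · exact h j (hge hj)
  have hw_one : ∀ j : ℕ+, ∑ n ∈ Finset.Ico 1 j, w n * b n j ≤ w j := by
    obtain ⟨κ, hκ, hκ1, h⟩ := hw_gen
    exact fun j => (hextend κ hκ h j).trans (mul_le_of_le_one_left (w.pos j).le hκ1)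
  have hunit : ∀ S : C0Semigroup 𝕜 (WeightedL1 𝕜 w),
      S.HasGenerator (lossOp 𝕜 a w + gainOp 𝕜 a b w).closure →
      ∀ n, S.GeneratorRel (WeightedL1.unit w n) (fragmentationColumn 𝕜 a b w n) := fun S hS n =>
    (hS _ _).1 (LinearPMap.le_graph_of_le (LinearPMap.le_closure _)
      (unit_mem_graph hb hb_zero hw_one n))
  refine ⟨isClosable_fragmentation ha hb hw_one hb_zero,
    ⟨fragmentationSemigroup 𝕜 ha hb hw_one,
      hasGenerator_fragmentationSemigroup ha hb hw_one hb_zero, fun T hT =>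
        C0Semigroup.eq_of_generatorRel (hunit T hT)
          (hunit _ (hasGenerator_fragmentationSemigroup ha hb hw_one hb_zero))⟩,
    fun S hS => ?_⟩
  replace hS := hunit S hS
  obtain ⟨M, hM, hM_unit⟩ := WeightedL1.exists_massCLM (𝕜 := 𝕜) hw
  let Q : ℝ≥0 → WeightedL1 𝕜 w →L[𝕜] WeightedL1 𝕜 w := fun t =>
    S.op t - M.smulRight (WeightedL1.unit w 1)
  have hQ : ∀ t u, S.op t u - u.mass • WeightedL1.unit w 1 = Q t u := fun t u => by
    simp [Q, hM]
  have hQ_unit : ∀ t (n : ℕ+), Q t (WeightedL1.unit w n) =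
      S.op t (WeightedL1.unit w n) - ((n : ℕ) : ℝ) • WeightedL1.unit w 1 := fun t n => by
    rw [RCLike.real_smul_eq_coe_smul (K := 𝕜)]
    simp [Q, hM_unit]
  have hQ_self : ∀ (t : ℝ≥0) {n : ℕ+}, n ≠ 1 →
      w n * Real.exp (-(a n) * t) ≤ ‖Q t (WeightedL1.unit w n)‖ := by
    intro t n hn
    refine le_trans (le_of_eq ?_) (WeightedL1.weight_mul_norm_apply_le _ n)
    rw [hQ_unit, WeightedL1.sub_apply, C0Semigroup.op_unit_apply_self hS,
      WeightedL1.real_smul_apply, WeightedL1.unit_apply, if_neg hn, mul_zero, sub_zero,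
      RCLike.norm_ofReal, abs_of_pos (Real.exp_pos _)]
  simp only [hQ]
  refine ⟨⟨fun h n hn => ?_, fun hpos u => ?_⟩, fun κ hκ hκ1 hκw a₀ ha₀ => ?_⟩
  · refine lt_of_le_of_ne (ha n) fun h0 => ?_
    have hn1 : n ≠ 1 := by
      rintro rfl
      exact absurd hn (by decide)
    -- If `a_n = 0`, the deviation of `e_n` never drops below `w_n`.
    refine absurd (ge_of_tendsto' (h (WeightedL1.unit w n)) fun t => ?_) (not_le.2 (w.pos n))
    simpa [← h0] using hQ_self t hn1
  -- With `κ = 1`, `β = 0` the estimate needs no lower bound on the rates; it provides the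
  -- dominating series.
  · have hbd : ∀ t n, ‖Q t (WeightedL1.unit w n)‖ ≤ (w 1 + 1) * w n := fun t n => by
      rw [hQ_unit]
      simpa using C0Semigroup.norm_deviation_unit_le hS ha hb hw ha_one h_mass (κ := 1) (β := 0)
        (by simpa using hw_one) (by simp) n t
    have hlim : ∀ n, Tendsto (fun t => ‖u n‖ * ‖Q t (WeightedL1.unit w n)‖) atTop (𝓝 0) := by
      intro n
      have h1 := ((C0Semigroup.isFragmentationFlow_deviation hS ha_one h_mass).tendsto_zero hpos
        (fun t _ => by simp [C0Semigroup.op_unit_one hS ha_one]) n).comp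
        (NNReal.tendsto_coe_atTop.2 tendsto_id)
      simpa [hQ_unit] using h1.norm.const_mul ‖u n‖
    have hsum := tendsto_tsum_of_dominated_convergence
      (WeightedL1.summable_norm_mul (C := w 1 + 1) (v := fun n => (w 1 + 1) * w n)
        (fun n => by
          have := w.pos 1
          have := w.pos n
          rw [Real.norm_of_nonneg (by positivity)]) u) hlim
      (Eventually.of_forall fun t n => by
        rw [norm_mul, norm_norm, norm_norm]
        exact mul_le_mul_of_nonneg_left ((hbd t n).trans (Real.le_norm_self _)) (norm_nonneg _))
    rw [tsum_zero] at hsum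
    exact squeeze_zero (fun _ => norm_nonneg _) (fun t => WeightedL1.norm_map_le_tsum (Q t) u) hsum
  · have hbdd : BddBelow (Set.range fun n : {n : ℕ+ // 2 ≤ n} => a n) :=
      ⟨0, by rintro _ ⟨n, rfl⟩; exact ha n⟩
    have hbound : ∀ (u : WeightedL1 𝕜 w) (t : ℝ≥0),
        ‖Q t u‖ ≤ (w 1 + 1) * Real.exp (-(1 - κ) * a₀ * t) * ‖u‖ := by
      intro u t
      refine WeightedL1.norm_map_le_of_unit (Q t) (fun n => ?_) u
      rw [hQ_unit]
      have := C0Semigroup.norm_deviation_unit_le hS ha hb hw ha_one h_mass (κ := κ)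
        (β := (1 - κ) * a₀) (hextend κ hκ hκw) (fun n hn => by
          refine mul_le_mul_of_nonneg_left ?_ (by linarith)
          rw [ha₀]
          exact ciInf_le hbdd ⟨n, hn⟩) n t
      rwa [← neg_mul] at this
    have hfail : ∀ α : ℝ, a₀ < α → ¬ ∀ u : WeightedL1 𝕜 w,
        Tendsto (fun t : ℝ≥0 => Real.exp (α * t) * ‖Q t u‖) atTop (𝓝 0) := by
      intro α hα h
      have : Nonempty {n : ℕ+ // 2 ≤ n} := ⟨⟨2, le_rfl⟩⟩
      -- Some `n ≥ 2` has `a_n < α`; for `u = e_n` the factor `e^{αt}` outweighs the decay `e^{-a_n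
      -- t}`.
      obtain ⟨⟨n, hn⟩, hnα⟩ := exists_lt_of_ciInf_lt (ha₀ ▸ hα)
      have hn1 : n ≠ 1 := by
        rintro rfl
        exact absurd hn (by decide)
      refine absurd (ge_of_tendsto' (h (WeightedL1.unit w n)) fun t => ?_) (not_le.2 (w.pos n))
      calc w n ≤ w n * Real.exp ((α - a n) * t) := by
            refine le_mul_of_one_le_right (w.pos n).le (Real.one_le_exp ?_)
            exact mul_nonneg (sub_nonneg.2 hnα.le) t.2
        _ = Real.exp (α * t) * (w n * Real.exp (-(a n) * t)) := by
            rw [mul_left_comm, ← Real.exp_add]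
            ring_nf
        _ ≤ _ := mul_le_mul_of_nonneg_left (hQ_self t hn1) (Real.exp_pos _).le
    refine ⟨hbound, fun _ α _ hα u => ?_, hfail, fun h0 α hα => hfail α (h0 ▸ hα)⟩
    have hexp : Tendsto (fun t : ℝ≥0 =>
        (w 1 + 1) * ‖u‖ * Real.exp ((α - (1 - κ) * a₀) * t)) atTop (𝓝 0) := by
      have h1 : Tendsto (fun t : ℝ≥0 => (α - (1 - κ) * a₀) * (t : ℝ)) atTop atBot :=
        (NNReal.tendsto_coe_atTop.2 tendsto_id).const_mul_atTop_of_neg (sub_neg.2 hα)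
      simpa using (Real.tendsto_exp_atBot.comp h1).const_mul ((w 1 + 1) * ‖u‖)
    refine squeeze_zero (fun t => by positivity) (fun t => ?_) hexp
    calc _ ≤ Real.exp (α * t) * ((w 1 + 1) * Real.exp (-(1 - κ) * a₀ * t) * ‖u‖) :=
          mul_le_mul_of_nonneg_left (hbound u t) (Real.exp_pos _).le
      _ = (w 1 + 1) * ‖u‖ * (Real.exp (α * t) * Real.exp (-(1 - κ) * a₀ * t)) := by ring
      _ = _ := by
          rw [← Real.exp_add]
          ring_nf
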